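/- A \emph{$T$-norm} is a commutative and associative map $\otimes:[0,1]^2\to[0,1]$ such that $x\le y$ implies $x\otimes z\le y\otimes z$, and $x\otimes 1=x$ for all $x\in[0,1]$. It is \emph{Archimedean} if for all $0<x,y<1$ there is an integer $n\ge 1$ such that $x\otimes\cdots\otimes x$ ($n$ factors) is at most $y$. A \emph{copula} is a map $f:[0,1]^2\to[0,1]$ that is monotone in each argument, has $1$ as a neutral element, and satisfies $f(x,w)-f(x,z)\le f(y,w)-f(y,z)$ for all $0\le x\le y\le 1$ and $0\le z\le w\le 1$. An \emph{Archimedean copula} is an Archimedean $T$-norm that is a copula. The \emph{dual} of a map $f:[0,1]^2\to[0,1]$ is $\Phi(f)(x,y)=1-f(1-x,1-y)$. A \emph{uninorm} is a commutative and associative map $[0,1]^2\to[0,1]$ that is monotone in the above sense and has an identity element $e\in[0,1]$. \textbf{Theorem.} Let $\otimes,\oplus:[0,1]^2\to[0,1]$ be such that $\otimes$ and $\Phi(\oplus)$ are both Archimedean copulas. Then $\otimes$ and $\oplus$ are uninorms, and for all $n\ge 1$, all $0\le x_1\le\cdots\le x_n\le 1$ and $0\le y_1\le\cdots\le y_n\le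 1$, and every permutation $\sigma\in S_n$, both the rearrangement inequality $$(x_n\otimes y_1)\oplus\cdots\oplus(x_1\otimes y_n)\le(x_{\sigma(1)}\otimes y_1)\oplus\cdots\oplus(x_{\sigma(n)}\otimes y_n)\le(x_1\otimes y_1)\oplus\cdots\oplus(x_n\otimes y_n)$$ and the dual rearrangement inequality $$(x_n\oplus y_1)\otimes\cdots\otimes(x_1\oplus y_n)\ge(x_{\sigma(1)}\oplus y_1)\otimes\cdots\otimes(x_{\sigma(n)}\oplus y_n)\ge(x_1\oplus y_1)\otimes\cdots\otimes(x_n\oplus y_n)$$ hold. -/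

import Mathlib

open scoped unitInterval

namespace FuzzyLogic

/-- A `T`-norm: a commutative, associative, monotone operation on `[0,1]` with identity `1`. -/
structure IsTNorm (op : I → I → I) : Prop where
  comm : ∀ x y, op x y = op y x
  assoc : ∀ x y z, op (op x y) z = op x (op y z)
  mono : ∀ x y z, x ≤ y → op x z ≤ op y z
  one_neutral : ∀ x, op x 1 = x

/-- A uninorm: as a `T`-norm, but with an arbitrary identity element `e ∈ [0,1]`. -/
structure IsUninorm (op : I → I → I) : Prop where
  comm : ∀ x y, op x y = op y x
  assoc : ∀ x y z, op (op x y) z = op x (op y z)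
  mono : ∀ x y z, x ≤ y → op x z ≤ op y z
  exists_neutral : ∃ e, ∀ x, op x e = x

/-- The dual of `op` with respect to the negation `x ↦ 1 - x`, which is `unitInterval.symm`:
`Φ(op)(x, y) = 1 - op (1 - x) (1 - y)`. -/
def dual (op : I → I → I) (x y : I) : I :=
  unitInterval.symm (op (unitInterval.symm x) (unitInterval.symm y))

/-- `fold op n a` is `a 0 ∘ a 1 ∘ ⋯ ∘ a n`, the (left-associated) combination of the nonempty
finite sequence `a 0, …, a n` by the operation `op`. -/
def fold (op : I → I → I) : (n : ℕ) → (Fin (n + 1) → I) → I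
  | 0, a => a 0
  | n + 1, a => op (fold op n fun i => a i.castSucc) (a (Fin.last (n + 1)))

/-- `op` is Archimedean: for all `0 < x, y < 1`, some power `x ∘ ⋯ ∘ x` (`n + 1` factors)
is at most `y`. -/
def IsArchimedean (op : I → I → I) : Prop :=
  ∀ x y : I, 0 < x → x < 1 → 0 < y → y < 1 → ∃ n : ℕ, fold op n (fun _ => x) ≤ y

/-- A copula: `1` is neutral, the function is monotone in each argument, and it is
`2`-increasing. -/
structure IsCopula (f : I → I → I) : Prop where
  right_neutral : ∀ x, f x 1 = x
  left_neutral : ∀ x, f 1 x = x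
  mono_left : ∀ x y z, x ≤ y → f x z ≤ f y z
  mono_right : ∀ x y z, x ≤ y → f z x ≤ f z y
  two_increasing : ∀ x y z w, x ≤ y → z ≤ w →
    (f x w : ℝ) - f x z ≤ (f y w : ℝ) - f y z

/-- An Archimedean copula: a `T`-norm that is both Archimedean and a copula. -/
structure IsArchimedeanCopula (f : I → I → I) : Prop where
  isTNorm : IsTNorm f
  isArchimedean : IsArchimedean f
  isCopula : IsCopula f

/-- The rearrangement inequality for a pair `(mul, add)` of uninorms. A nonempty sequence is
indexed by `Fin (n + 1)`, and `Fin.rev` reverses the order of the indices. -/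
structure RearrangementInequality (mul add : I → I → I) : Prop where
  mul_uninorm : IsUninorm mul
  add_uninorm : IsUninorm add
  lower : ∀ (n : ℕ) (x y : Fin (n + 1) → I), Monotone x → Monotone y →
    ∀ s : Equiv.Perm (Fin (n + 1)),
      fold add n (fun i => mul (x i.rev) (y i)) ≤ fold add n (fun i => mul (x (s i)) (y i))
  upper : ∀ (n : ℕ) (x y : Fin (n + 1) → I), Monotone x → Monotone y →
    ∀ s : Equiv.Perm (Fin (n + 1)),
      fold add n (fun i => mul (x (s i)) (y i)) ≤ fold add n (fun i => mul (x i) (y i))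

/-- The dual rearrangement inequality for a pair `(mul, add)` of uninorms. -/
structure DualRearrangementInequality (mul add : I → I → I) : Prop where
  mul_uninorm : IsUninorm mul
  add_uninorm : IsUninorm add
  upper : ∀ (n : ℕ) (x y : Fin (n + 1) → I), Monotone x → Monotone y →
    ∀ s : Equiv.Perm (Fin (n + 1)),
      fold mul n (fun i => add (x (s i)) (y i)) ≤ fold mul n (fun i => add (x i.rev) (y i))
  lower : ∀ (n : ℕ) (x y : Fin (n + 1) → I), Monotone x → Monotone y →
    ∀ s : Equiv.Perm (Fin (n + 1)),
      fold mul n (fun i => add (x i) (y i)) ≤ fold mul n (fun i => add (x (s i)) (y i))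

end FuzzyLogic

open scoped unitInterval

namespace FuzzyLogic

open unitInterval

/-! Everything reduces to exchanging two entries. The `2`-increasing property compares the real sums
of the two diagonals of a `2 × 2` array of values, and monotonicity makes one diagonal the more
spread-out pair. An associative copula is Schur-concave (`IsCopula.schur_concave`), so it turns this
comparison of sums into an inequality between combined values. An induction over permutations
(`fold_perm_le_fold`) then extends the exchange of two entries to sequences. -/

/-- A copula is `1`-Lipschitz in its second argument. -/
theorem IsCopula.sub_le {f : I → I → I} (hf : IsCopula f) (b : I) {z w : I} (h : z ≤ w) :
    (f b w : ℝ) - f b z ≤ w - z := by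
  simpa only [hf.left_neutral] using hf.two_increasing b 1 z w le_one' h

theorem IsCopula.apply_zero {f : I → I → I} (hf : IsCopula f) (b : I) : f b 0 = 0 := by
  refine le_antisymm ?_ nonneg'
  simpa only [hf.left_neutral] using hf.mono_left b 1 0 le_one'

theorem IsCopula.continuous_right {f : I → I → I} (hf : IsCopula f) (b : I) :
    Continuous (f b) := by
  have key : ∀ z w : I, z ≤ w → dist (f b z) (f b w) ≤ dist z w := fun z w h => by
    have h₁ : (f b z : ℝ) ≤ f b w := hf.mono_right z w b h
    have h₂ : (z : ℝ) ≤ w := h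
    rw [Subtype.dist_eq, Subtype.dist_eq, Real.dist_eq, Real.dist_eq, abs_sub_comm,
      abs_of_nonneg (sub_nonneg.2 h₁), abs_sub_comm, abs_of_nonneg (sub_nonneg.2 h₂)]
    exact hf.sub_le b h
  refine (LipschitzWith.mk_one fun z w => ?_).continuous
  rcases le_total z w with h | h
  · exact key z w h
  · rw [dist_comm, dist_comm z]
    exact key w z h

/-- Every value below `b` is of the form `f b t`, by the intermediate value theorem. -/
theorem IsCopula.exists_apply_eq {f : I → I → I} (hf : IsCopula f) {a b : I} (h : a ≤ b) :
    ∃ t, f b t = a := by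
  have hmem : a ∈ Set.Icc (f b 0) (f b 1) := by
    rw [hf.apply_zero, hf.right_neutral]
    exact ⟨nonneg', h⟩
  exact intermediate_value_univ 0 1 (hf.continuous_right b) hmem

/-- An associative copula is Schur-concave. -/
theorem IsCopula.schur_concave {f : I → I → I} (hf : IsCopula f)
    (assoc : ∀ x y z, f (f x y) z = f x (f y z)) (comm : ∀ x y, f x y = f y x)
    {a b c d : I} (hab : a ≤ b) (hbd : b ≤ d) (h : (a : ℝ) + d ≤ b + c) :
    f a d ≤ f b c := by
  -- With `a = f b t`, associativity leaves `f t d ≤ c`. The `2`-increasing property on `[b, d] ×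
  -- [t, 1]` gives `f d t ≤ a + d - b ≤ c`.
  obtain ⟨t, rfl⟩ := hf.exists_apply_eq hab
  rw [assoc]
  refine hf.mono_right _ _ _ ?_
  have key := hf.two_increasing b d t 1 hbd le_one'
  rw [hf.right_neutral, hf.right_neutral] at key
  rw [comm t d]
  change (f d t : ℝ) ≤ c
  linarith

theorem dual_dual (f : I → I → I) : dual (dual f) = f := by
  funext x y
  simp only [dual, symm_symm]

theorem coe_dual_symm (f : I → I → I) (x y : I) : (dual f (σ x) (σ y) : ℝ) = 1 - f x y := by
  simp only [dual, symm_symm, coe_symm_eq]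

theorem IsTNorm.isUninorm {f : I → I → I} (hf : IsTNorm f) : IsUninorm f :=
  ⟨hf.comm, hf.assoc, hf.mono, 1, hf.one_neutral⟩

theorem IsUninorm.dual {f : I → I → I} (hf : IsUninorm f) : IsUninorm (dual f) where
  comm x y := congrArg σ (hf.comm _ _)
  assoc x y z := by simp only [FuzzyLogic.dual, symm_symm, hf.assoc]
  mono x y z h := symm_le_symm.2 (hf.mono _ _ _ (symm_le_symm.2 h))
  exists_neutral := by
    obtain ⟨e, he⟩ := hf.exists_neutral
    exact ⟨σ e, fun x => by simp only [FuzzyLogic.dual, symm_symm, he]⟩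

theorem IsUninorm.mono_right {f : I → I → I} (hf : IsUninorm f) {x y : I} (z : I) (h : x ≤ y) :
    f z x ≤ f z y := by
  rw [hf.comm z x, hf.comm z y]
  exact hf.mono x y z h

/-- Complementing reverses the order, so `σ (mul x₂ y₂)` and `σ (mul x₁ y₁)` are the extreme values,
and Schur-concavity of `dual add` applies. -/
theorem add_mul_exchange {mul add : I → I → I} (hmul : IsCopula mul)
    (hcop : IsCopula (dual add)) (hadd : IsUninorm (dual add)) {x₁ x₂ y₁ y₂ : I}
    (hx : x₁ ≤ x₂) (hy : y₁ ≤ y₂) :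
    add (mul x₂ y₁) (mul x₁ y₂) ≤ add (mul x₁ y₁) (mul x₂ y₂) := by
  have key : dual add (σ (mul x₂ y₂)) (σ (mul x₁ y₁)) ≤
      dual add (σ (mul x₂ y₁)) (σ (mul x₁ y₂)) := by
    refine hcop.schur_concave hadd.assoc hadd.comm
      (symm_le_symm.2 (hmul.mono_right _ _ _ hy)) (symm_le_symm.2 (hmul.mono_left _ _ _ hx)) ?_
    have := hmul.two_increasing x₁ x₂ y₁ y₂ hx hy
    simp only [coe_symm_eq]
    linarith
  rw [hadd.comm (σ (mul x₂ y₂))] at key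
  simpa only [dual, symm_symm, symm_le_symm] using key

/-- Complementing turns the `2`-increasing property of `dual add` into submodularity of `add`, which
is the sum condition for Schur-concavity of `mul`. -/
theorem mul_add_exchange {mul add : I → I → I} (hcop : IsCopula mul) (hmul : IsUninorm mul)
    (hadd : IsCopula (dual add)) (hadd' : IsUninorm add) {x₁ x₂ y₁ y₂ : I}
    (hx : x₁ ≤ x₂) (hy : y₁ ≤ y₂) :
    mul (add x₁ y₁) (add x₂ y₂) ≤ mul (add x₂ y₁) (add x₁ y₂) := by
  refine hcop.schur_concave hmul.assoc hmul.comm (hadd'.mono _ _ _ hx)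
    (hadd'.mono_right _ hy) ?_
  have := hadd.two_increasing (σ x₂) (σ x₁) (σ y₂) (σ y₁) (symm_le_symm.2 hx) (symm_le_symm.2 hy)
  simp only [coe_dual_symm] at this
  linarith

/-- The rearrangement inequality for a Monge array: if the exchange of two rows never increases
the combination of two entries on an increasing diagonal, the identity permutation is optimal. -/
theorem fold_perm_le_fold {ι α : Type*} [LinearOrder ι] [Preorder α] (op : α → α → α)
    [Std.Commutative op] [Std.Associative op] (mono : ∀ x y z, x ≤ y → op x z ≤ op y z) (e : α)
    (f : ι → ι → α)
    (hf : ∀ i j k l, i ≤ j → k ≤ l → op (f j k) (f i l) ≤ op (f i k) (f j l))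
    (s : Finset ι) : ∀ p : Equiv.Perm ι, (∀ i, p i ≠ i → i ∈ s) →
      s.fold op e (fun i => f (p i) i) ≤ s.fold op e (fun i => f i i) := by
  have comm : ∀ x y, op x y = op y x := Std.Commutative.comm
  have assoc : ∀ x y z, op (op x y) z = op x (op y z) := Std.Associative.assoc
  have mono' : ∀ x y z, x ≤ y → op z x ≤ op z y := fun x y z h => by
    rw [comm z x, comm z y]
    exact mono x y z h
  -- Adding the largest index `a` last ensures that both `p a` and the preimage `b` of `a` are at
  -- most `a`.
  induction s using Finset.induction_on_max with
  | empty => exact fun p _ => le_rfl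
  | insert a s hs ih =>
    intro p hp
    have ha : a ∉ s := fun h => lt_irrefl a (hs a h)
    rw [Finset.fold_insert ha, Finset.fold_insert ha]
    by_cases hpa : p a = a
    · rw [hpa]
      refine mono' _ _ _ (ih p fun i hi => ?_)
      refine (Finset.mem_insert.1 (hp i hi)).resolve_left ?_
      rintro rfl
      exact hi hpa
    have hmem : ∀ i, p i ≠ i → i ≤ a := fun i hi =>
      (Finset.mem_insert.1 (hp i hi)).elim (fun h => h.le) fun h => (hs i h).le
    have hpale : p a ≤ a := hmem _ fun h => hpa (p.injective h)
    obtain ⟨b, hb⟩ := p.surjective a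
    have hba : b ≠ a := by
      rintro rfl
      exact hpa hb
    have hbs : b ∈ s :=
      (Finset.mem_insert.1 (hp b (by rw [hb]; exact hba.symm))).resolve_left hba
    -- `q` fixes `a` and sends `b` to `p a`. It differs from `p` only in columns `a` and `b`, where
    -- one exchange compares the two.
    let q : Equiv.Perm ι := p.trans (Equiv.swap a (p a))
    have hqb : q b = p a := by simp [q, hb]
    have hq : ∀ i, i ≠ a → i ≠ b → q i = p i := fun i hia hib =>
      Equiv.swap_apply_of_ne_of_ne (fun h => hib (p.injective (h.trans hb.symm)))
        fun h => hia (p.injective h)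
    have hqs : ∀ i, q i ≠ i → i ∈ s := fun i hi => by
      by_cases hia : i = a
      · subst hia
        exact absurd (by simp [q]) hi
      by_cases hib : i = b
      · exact hib ▸ hbs
      rw [hq i hia hib] at hi
      exact (Finset.mem_insert.1 (hp i hi)).resolve_left hia
    refine le_trans ?_ (mono' _ _ _ (ih q hqs))
    have hbt : b ∉ s.erase b := Finset.notMem_erase b s
    rw [← Finset.insert_erase hbs, Finset.fold_insert hbt, Finset.fold_insert hbt, hqb, hb]
    have hrest : (s.erase b).fold op e (fun i => f (q i) i) =
        (s.erase b).fold op e (fun i => f (p i) i) := by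
      refine Finset.fold_congr fun i hi => ?_
      rw [hq i (fun h => ha (h ▸ Finset.mem_of_mem_erase hi)) (Finset.ne_of_mem_erase hi)]
    rw [hrest, ← assoc, ← assoc]
    refine mono _ _ _ ?_
    rw [comm, comm (f a a)]
    exact hf _ _ _ _ hpale (hs b hbs).le

/-- The neutral element is a harmless starting value, so the bracketed product becomes an unordered
one. -/
theorem fold_eq_finset_fold {op : I → I → I} [Std.Commutative op] [Std.Associative op] {e : I}
    (he : ∀ x, op x e = x) (n : ℕ) (a : Fin (n + 1) → I) :
    fold op n a = Finset.univ.fold op e a := by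
  induction n with
  | zero => simp [fold, he]
  | succ n ih =>
    rw [Fin.univ_castSuccEmb, Finset.fold_cons, Finset.fold_map, fold, ih,
      Std.Commutative.comm (op := op)]
    rfl

theorem IsUninorm.fold_le_fold {op : I → I → I} (hop : IsUninorm op) {n : ℕ}
    {f : Fin (n + 1) → Fin (n + 1) → I}
    (hf : ∀ i j k l, i ≤ j → k ≤ l → op (f j k) (f i l) ≤ op (f i k) (f j l))
    (p : Equiv.Perm (Fin (n + 1))) :
    fold op n (fun i => f (p i) i) ≤ fold op n (fun i => f i i) := by
  obtain ⟨e, he⟩ := hop.exists_neutral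
  have : Std.Commutative op := ⟨hop.comm⟩
  have : Std.Associative op := ⟨hop.assoc⟩
  rw [fold_eq_finset_fold he, fold_eq_finset_fold he]
  exact fold_perm_le_fold op hop.mono e f hf _ p fun i _ => Finset.mem_univ i

theorem IsUninorm.fold_ge_fold {op : I → I → I} (hop : IsUninorm op) {n : ℕ}
    {f : Fin (n + 1) → Fin (n + 1) → I}
    (hf : ∀ i j k l, i ≤ j → k ≤ l → op (f i k) (f j l) ≤ op (f j k) (f i l))
    (p : Equiv.Perm (Fin (n + 1))) :
    fold op n (fun i => f i i) ≤ fold op n (fun i => f (p i) i) := by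
  obtain ⟨e, he⟩ := hop.exists_neutral
  have : Std.Commutative op := ⟨hop.comm⟩
  have : Std.Associative op := ⟨hop.assoc⟩
  rw [fold_eq_finset_fold he, fold_eq_finset_fold he]
  -- In the order dual, the reversed exchange inequality is the one required by `fold_perm_le_fold`.
  have : Std.Commutative (α := Iᵒᵈ) op := ⟨hop.comm⟩
  have : Std.Associative (α := Iᵒᵈ) op := ⟨hop.assoc⟩
  exact fold_perm_le_fold (α := Iᵒᵈ) op (fun x y z h => hop.mono y x z h) e f hf _ p
    fun i _ => Finset.mem_univ i

end FuzzyLogic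

open FuzzyLogic in
theorem mainTheorem5 (mul add : unitInterval → unitInterval → unitInterval)
    (hmul : FuzzyLogic.IsArchimedeanCopula mul)
    (hadd : FuzzyLogic.IsArchimedeanCopula (FuzzyLogic.dual add)) :
    FuzzyLogic.RearrangementInequality mul add ∧
      FuzzyLogic.DualRearrangementInequality mul add := by
  have hm : IsUninorm mul := hmul.isTNorm.isUninorm
  have hd : IsUninorm (dual add) := hadd.isTNorm.isUninorm
  have ha : IsUninorm add := dual_dual add ▸ hd.dual
  refine ⟨⟨hm, ha, fun n x y hx hy s => ?_, fun n x y hx hy s => ?_⟩,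
    ⟨hm, ha, fun n x y hx hy s => ?_, fun n x y hx hy s => ?_⟩⟩
  -- Reversing the rows makes the antidiagonal the identity arrangement; composing `s` with the
  -- reversal cancels this on the other side.
  · have := ha.fold_ge_fold (f := fun i k => mul (x i.rev) (y k))
      (fun i j k l hij hkl => add_mul_exchange hmul.isCopula hadd.isCopula hd
        (hx (Fin.rev_le_rev.2 hij)) (hy hkl)) (s.trans Fin.revPerm)
    simpa using this
  · exact ha.fold_le_fold (f := fun i k => mul (x i) (y k))
      (fun i j k l hij hkl => add_mul_exchange hmul.isCopula hadd.isCopula hd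
        (hx hij) (hy hkl)) s
  · have := hm.fold_le_fold (f := fun i k => add (x i.rev) (y k))
      (fun i j k l hij hkl => mul_add_exchange hmul.isCopula hm hadd.isCopula ha
        (hx (Fin.rev_le_rev.2 hij)) (hy hkl)) (s.trans Fin.revPerm)
    simpa using this
  · exact hm.fold_ge_fold (f := fun i k => add (x i) (y k))
      (fun i j k l hij hkl => mul_add_exchange hmul.isCopula hm hadd.isCopula ha
        (hx hij) (hy hkl)) s
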